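/- Let $\bar A\in\mathbb R^{k\times n}$, $\bar b\in\mathbb R^k$, let $Q\subset\mathbb R^k$ be closed, let $\bar x\in\mathbb R^n$ satisfy $\bar A\bar x-\bar b\in Q$, and let $\Delta\mathcal U\subset\mathbb R^{k\times n}\times\mathbb R^k$ be a set. Put $L(\Delta A,\Delta b)=(\Delta A)\bar x-\Delta b$. For a set $C\subset\mathbb R^m$ and $x\in C$, the tangent cone $T_C(x)$ is the set of all $w$ for which there are $x_i\in C$, $x_i\to x$, and $t_i\searrow0$ with $(x_i-x)/t_i\to w$. The regular normal cone $\hat N_C(x)$ is the set of all $v$ with $v^T(y-x)\le o(|y-x|)$ for $y\in C$. The normal cone $N_C(x)$ is the set of all limits of sequences $v_i\in\hat N_C(x_i)$ with $x_i\in C$ and $x_i\to x$. The set $C$ is Clarke regular at $x$ if $N_C(x)=\hat N_C(x)$. Define $$\Psi=\{y\in\mathbb R^k: y+L(\Delta\mathcal U)\subset T_Q(\bar A\bar x-\bar b)\},\qquad \Gamma=\{\gamma\in\mathbb R^n:\bar A\gamma+L(\Delta\mathcal U)\subset T_Q(\bar A\bar x-\bar b)\}=\{\gamma:\bar A\gamma\in\Psi\}.$$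 Suppose that $Q$ is Clarke regular at $\bar A\bar x-\bar b$ and that there is a vector $\gamma'\in\mathbb R^n$ with $\bar A\gamma'\in\operatorname{int}\,T_Q(\bar A\bar x-\bar b)$. Then for every $\gamma\in\Gamma$, $$N_\Gamma(\gamma)=\{\bar A^Tv: v\in N_\Psi(\bar A\gamma)\}.$$ -/

import Mathlib

open Filter Topology

noncomputable section

namespace RobustTangent

section Cones

variable {E : Type*} [NormedAddCommGroup E] [InnerProductSpace ℝ E]

/-- The regular normals to `C` at a point `x` of `C`: the vectors `v` such that
`⟪v, y - x⟫ ≤ o(‖y - x‖)` for `y ∈ C`. -/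
def regularNormalCone (C : Set E) (x : E) : Set E :=
  {v | ∀ ε > 0, ∀ᶠ y in 𝓝[C] x, inner ℝ v (y - x) ≤ ε * ‖y - x‖}

/-- The (general, limiting) normal cone to `C` at a point `x` of `C`: limits of regular normals
taken at points of `C` that converge to `x`. -/
def normalCone (C : Set E) (x : E) : Set E :=
  {v | ∃ (xs vs : ℕ → E), (∀ i, xs i ∈ C) ∧ Tendsto xs atTop (𝓝 x) ∧
    (∀ i, vs i ∈ regularNormalCone C (xs i)) ∧ Tendsto vs atTop (𝓝 v)}

/-- Clarke regularity of `C` at a point `x` of `C`: every normal is a regular normal. -/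
def ClarkeRegularAt (C : Set E) (x : E) : Prop :=
  normalCone C x = regularNormalCone C x

/-- The (Bouligand) tangent cone to `C` at a point `x` of `C`: the limits of `(xᵢ - x) / tᵢ`
with `xᵢ ∈ C`, `xᵢ → x` and `tᵢ ↘ 0`. -/
def tangentCone (C : Set E) (x : E) : Set E :=
  {w | ∃ (xs : ℕ → E) (t : ℕ → ℝ), (∀ i, xs i ∈ C) ∧ Tendsto xs atTop (𝓝 x) ∧
    (∀ i, 0 < t i) ∧ Antitone t ∧ Tendsto t atTop (𝓝 0) ∧
    Tendsto (fun i => (t i)⁻¹ • (xs i - x)) atTop (𝓝 w)}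

end Cones

section Program

variable {n k : ℕ}

/-- The linear map `L(ΔA, Δb) = (ΔA) x̄ - Δb`. -/
def perturbation (xbar : EuclideanSpace ℝ (Fin n))
    (p : Matrix (Fin k) (Fin n) ℝ × EuclideanSpace ℝ (Fin k)) : EuclideanSpace ℝ (Fin k) :=
  p.1.toEuclideanLin xbar - p.2

/-- `Ψ = {y | y + L(ΔU) ⊆ T_Q(Ā x̄ - b̄)}`. -/
def Psi (A : Matrix (Fin k) (Fin n) ℝ) (b : EuclideanSpace ℝ (Fin k))
    (Q : Set (EuclideanSpace ℝ (Fin k)))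
    (U : Set (Matrix (Fin k) (Fin n) ℝ × EuclideanSpace ℝ (Fin k)))
    (xbar : EuclideanSpace ℝ (Fin n)) : Set (EuclideanSpace ℝ (Fin k)) :=
  {y | ∀ u ∈ perturbation xbar '' U, y + u ∈ tangentCone Q (A.toEuclideanLin xbar - b)}

/-- The tangential feasible set `Γ = {γ | Ā γ + L(ΔU) ⊆ T_Q(Ā x̄ - b̄)}`. -/
def Gam (A : Matrix (Fin k) (Fin n) ℝ) (b : EuclideanSpace ℝ (Fin k))
    (Q : Set (EuclideanSpace ℝ (Fin k)))
    (U : Set (Matrix (Fin k) (Fin n) ℝ × EuclideanSpace ℝ (Fin k)))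
    (xbar : EuclideanSpace ℝ (Fin n)) : Set (EuclideanSpace ℝ (Fin n)) :=
  {γ | ∀ u ∈ perturbation xbar '' U,
    A.toEuclideanLin γ + u ∈ tangentCone Q (A.toEuclideanLin xbar - b)}

end Program

end RobustTangent

end

open Filter Topology

namespace RobustTangent

/-! ### Normal and tangent cones of closed and convex sets. -/

section Normals

variable {E : Type*} [NormedAddCommGroup E] [InnerProductSpace ℝ E]

/-! Clarke regularity makes the tangent cone `T` of `Q` the polar of the regular normal cone, hence
a convex cone closed under addition. So `Psi`, an intersection of translates of `T`, is convex, and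
`Gam` is its preimage under `A`. If `A γ ∈ Psi` and `A γ' ∈ interior T`, then `A γ + interior T` is
an open subset of `Psi` containing `A (γ + γ')`: this is the Slater point for the convex chain rule
`normalCone_preimage_of_convex`, proved by separation in `F × ℝ`. The hard inclusion, that the polar
of the normal cone consists of tangents, is `mem_tangentCone_of_mem_polar`: along such a direction,
small Euler steps with projection show that the distance to the closed set is `o(T)`. -/

theorem smul_mem_regularNormalCone {C : Set E} {x v : E} (hv : v ∈ regularNormalCone C x)
    {c : ℝ} (hc : 0 < c) : c • v ∈ regularNormalCone C x := by
  intro ε hε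
  filter_upwards [hv (ε / c) (div_pos hε hc)] with y hy
  rw [real_inner_smul_left]
  calc c * inner ℝ v (y - x) ≤ c * (ε / c * ‖y - x‖) := by gcongr
    _ = ε * ‖y - x‖ := by field_simp

theorem regularNormalCone_subset_normalCone {C : Set E} {x : E} (hx : x ∈ C) :
    regularNormalCone C x ⊆ normalCone C x := fun v hv =>
  ⟨fun _ => x, fun _ => v, fun _ => hx, tendsto_const_nhds, fun _ => hv, tendsto_const_nhds⟩

/-- Proximal normals are regular normals. -/
theorem sub_mem_regularNormalCone_of_nearest {C : Set E} {z p : E}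
    (hp : ∀ y ∈ C, ‖z - p‖ ≤ ‖z - y‖) : z - p ∈ regularNormalCone C p := by
  intro ε hε
  have hball : ∀ᶠ y in 𝓝[C] p, y ∈ Metric.ball p ε :=
    mem_nhdsWithin_of_mem_nhds (Metric.ball_mem_nhds p hε)
  filter_upwards [hball, self_mem_nhdsWithin] with y hy hyC
  rw [mem_ball_iff_norm] at hy
  have h1 := hp y hyC
  have h2 : ‖z - y‖ ^ 2 = ‖z - p‖ ^ 2 - 2 * inner ℝ (z - p) (y - p) + ‖y - p‖ ^ 2 := by
    rw [← norm_sub_sq_real]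
    congr 2
    abel
  have h3 : ‖z - p‖ ^ 2 ≤ ‖z - y‖ ^ 2 := by gcongr
  nlinarith [norm_nonneg (y - p), mul_le_mul_of_nonneg_right hy.le (norm_nonneg (y - p))]

/-- Tangents make obtuse angles with regular normals. -/
theorem inner_nonpos_of_mem_tangentCone {C : Set E} {x v w : E}
    (hv : v ∈ regularNormalCone C x) (hw : w ∈ tangentCone C x) : inner ℝ v w ≤ 0 := by
  obtain ⟨xs, t, hC, hx, ht, -, -, hlim⟩ := hw
  have hwithin : Tendsto xs atTop (𝓝[C] x) :=
    tendsto_nhdsWithin_iff.2 ⟨hx, Eventually.of_forall hC⟩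
  have key : ∀ ε > 0, inner ℝ v w ≤ ε * ‖w‖ := by
    intro ε hε
    refine le_of_tendsto_of_tendsto (tendsto_const_nhds.inner hlim) (hlim.norm.const_mul ε) ?_
    filter_upwards [hwithin.eventually (hv ε hε)] with i hi
    rw [real_inner_smul_right, norm_smul, Real.norm_of_nonneg (inv_nonneg.2 (ht i).le)]
    calc (t i)⁻¹ * inner ℝ v (xs i - x) ≤ (t i)⁻¹ * (ε * ‖xs i - x‖) :=
          mul_le_mul_of_nonneg_left hi (inv_nonneg.2 (ht i).le)
      _ = ε * ((t i)⁻¹ * ‖xs i - x‖) := by ring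
  refine le_of_forall_pos_le_add fun ε hε => ?_
  have h := key (ε / (‖w‖ + 1)) (by positivity)
  have h2 : ε / (‖w‖ + 1) * ‖w‖ ≤ ε := by
    rw [div_mul_eq_mul_div, div_le_iff₀ (by positivity)]
    nlinarith [norm_nonneg w]
  linarith

/-- A direction in the polar of the normal cone makes an almost obtuse angle with the regular
normals at nearby points. -/
theorem exists_forall_inner_le_of_mem_polar [FiniteDimensional ℝ E] {C : Set E} {x w : E}
    (hw : ∀ v ∈ normalCone C x, inner ℝ v w ≤ 0) {η : ℝ} (hη : 0 < η) :
    ∃ δ > 0, ∀ p ∈ C, ‖p - x‖ < δ → ∀ v ∈ regularNormalCone C p, inner ℝ v w ≤ η * ‖v‖ := by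
  -- Compactness: violating normals, scaled to unit length, accumulate at a normal `v₀` with `⟪v₀,
  -- w⟫ ≥ η > 0`.
  by_contra! hcon
  choose p hpC hpx v hv hlt using fun i : ℕ =>
    hcon (1 / ((i : ℝ) + 1)) Nat.one_div_pos_of_nat
  have hv0 : ∀ i, 0 < ‖v i‖ := by
    intro i
    rw [norm_pos_iff]
    intro h0
    have := hlt i
    simp [h0] at this
  obtain ⟨v₀, -, φ, hφ, hlim⟩ := tendsto_subseq_of_bounded
    (x := fun i => ‖v i‖⁻¹ • v i) (s := Metric.closedBall 0 1) Metric.isBounded_closedBall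
    (fun i => by
      rw [mem_closedBall_zero_iff, norm_smul, norm_inv, norm_norm,
        inv_mul_cancel₀ (hv0 i).ne'])
  have hp : Tendsto p atTop (𝓝 x) := by
    rw [tendsto_iff_norm_sub_tendsto_zero]
    exact squeeze_zero (fun _ => norm_nonneg _) (fun i => (hpx i).le)
      tendsto_one_div_add_atTop_nhds_zero_nat
  have hv₀ : v₀ ∈ normalCone C x :=
    ⟨p ∘ φ, _, fun i => hpC _, hp.comp hφ.tendsto_atTop,
      fun i => smul_mem_regularNormalCone (hv (φ i)) (inv_pos.2 (hv0 (φ i))), hlim⟩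
  have hge : η ≤ inner ℝ v₀ w := by
    refine ge_of_tendsto (hlim.inner tendsto_const_nhds) (Eventually.of_forall fun i => ?_)
    simp only [Function.comp_apply]
    rw [real_inner_smul_left, inv_mul_eq_div, le_div_iff₀ (hv0 _)]
    exact (hlt _).le
  linarith [hw v₀ hv₀]

/-- One Euler step for the squared distance to a closed set. -/
theorem infDist_add_smul_sq_le [FiniteDimensional ℝ E] {C : Set E} (hC : IsClosed C) {x w : E}
    (hx : x ∈ C) {η δ : ℝ}
    (hδ : ∀ p ∈ C, ‖p - x‖ < δ → ∀ v ∈ regularNormalCone C p, inner ℝ v w ≤ η * ‖v‖)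
    {z : E} (hz : 2 * ‖z - x‖ < δ) {h : ℝ} (hh : 0 ≤ h) :
    Metric.infDist (z + h • w) C ^ 2 ≤
      Metric.infDist z C ^ 2 + 2 * h * η * Metric.infDist z C + h ^ 2 * ‖w‖ ^ 2 := by
  obtain ⟨p, hpC, hp⟩ := hC.exists_infDist_eq_dist ⟨x, hx⟩ z
  have hzx : Metric.infDist z C ≤ ‖z - x‖ := by
    rw [← dist_eq_norm]; exact Metric.infDist_le_dist_of_mem hx
  rw [dist_eq_norm] at hp
  have hpx : ‖p - x‖ < δ := by
    have h1 : ‖p - x‖ ≤ ‖z - x‖ + ‖z - p‖ := by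
      have : p - x = (z - x) - (z - p) := by abel
      rw [this]; exact norm_sub_le _ _
    linarith
  have hn : z - p ∈ regularNormalCone C p := by
    refine sub_mem_regularNormalCone_of_nearest fun y hy => ?_
    rw [← hp, ← dist_eq_norm]
    exact Metric.infDist_le_dist_of_mem hy
  have hin := hδ p hpC hpx _ hn
  have hle : Metric.infDist (z + h • w) C ≤ ‖(z - p) + h • w‖ := by
    have : (z - p) + h • w = (z + h • w) - p := by abel
    rw [this, ← dist_eq_norm]
    exact Metric.infDist_le_dist_of_mem hpC
  -- The first-order term of the square is controlled because `z - p` is a regular normal at the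
  -- nearest point `p`.
  calc Metric.infDist (z + h • w) C ^ 2 ≤ ‖(z - p) + h • w‖ ^ 2 :=
        pow_le_pow_left₀ Metric.infDist_nonneg hle 2
    _ = ‖z - p‖ ^ 2 + 2 * (h * inner ℝ (z - p) w) + h ^ 2 * ‖w‖ ^ 2 := by
        rw [norm_add_sq_real, real_inner_smul_right, norm_smul, mul_pow, Real.norm_eq_abs, sq_abs]
    _ ≤ ‖z - p‖ ^ 2 + 2 * (h * (η * ‖z - p‖)) + h ^ 2 * ‖w‖ ^ 2 := by gcongr
    _ = _ := by rw [hp]; ring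

/-- The distance to a closed set grows sublinearly along directions in the polar of the normal
cone. -/
theorem exists_forall_infDist_le_of_mem_polar [FiniteDimensional ℝ E] {C : Set E}
    (hC : IsClosed C) {x w : E} (hx : x ∈ C) (hw : ∀ v ∈ normalCone C x, inner ℝ v w ≤ 0)
    {c : ℝ} (hc : 0 < c) :
    ∃ δ > 0, ∀ T, 0 < T → T < δ → Metric.infDist (x + T • w) C ≤ c * T := by
  -- The Euler steps will leave `η * ‖w‖ * T ^ 2` in the limit; the `+ 1` covers `w = 0`.
  set η : ℝ := c ^ 2 / (‖w‖ + 1) with hηdef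
  have hη : 0 < η := by positivity
  have hηw : η * ‖w‖ ≤ c ^ 2 := by
    rw [hηdef, div_mul_eq_mul_div, div_le_iff₀ (by positivity)]
    nlinarith [norm_nonneg w, sq_nonneg c]
  obtain ⟨δ, hδ0, hδ⟩ := exists_forall_inner_le_of_mem_polar hw hη
  -- A nearest point to `z` is within `2 * ‖z - x‖` of `x`, so this keeps all projections within
  -- `δ`.
  refine ⟨δ / (2 * (‖w‖ + 1)), by positivity, fun T hT hTδ => ?_⟩
  have hTδ' : 2 * (T * ‖w‖) < δ := by
    rw [lt_div_iff₀ (by positivity)] at hTδ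
    nlinarith
  have hlen : ∀ s : ℝ, 0 ≤ s → ‖(x + s • w) - x‖ = s * ‖w‖ := fun s hs => by
    rw [add_sub_cancel_left, norm_smul, Real.norm_of_nonneg hs]
  -- The crude bound `i * h * ‖w‖` on the distance makes the first-order increments grow like `2 *
  -- i`, which `(i + 1) ^ 2 - i ^ 2` absorbs.
  have hiter : ∀ N : ℕ, 0 < N → ∀ i : ℕ, i ≤ N →
      Metric.infDist (x + ((i : ℝ) * (T / N)) • w) C ^ 2 ≤
        η * ‖w‖ * (T / N) ^ 2 * (i : ℝ) ^ 2 + i * (T / N) ^ 2 * ‖w‖ ^ 2 := by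
    intro N hN i
    have hN' : (0 : ℝ) < N := Nat.cast_pos.2 hN
    have hh : 0 ≤ T / N := by positivity
    induction i with
    | zero => intro _; simp [Metric.infDist_zero_of_mem hx]
    | succ i ih =>
      intro hi
      have ih' := ih (by omega)
      set h := T / N with hhdef
      have hs : (0 : ℝ) ≤ i * h := by positivity
      have hsT : (i : ℝ) * h ≤ T := by
        have hiN : (i : ℝ) ≤ N := by exact_mod_cast (by omega : i ≤ N)
        calc (i : ℝ) * h ≤ N * h := by gcongr
          _ = T := by rw [hhdef]; field_simp
      have hz : 2 * ‖(x + ((i : ℝ) * h) • w) - x‖ < δ := by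
        rw [hlen _ hs]
        nlinarith [norm_nonneg w, mul_le_mul_of_nonneg_right hsT (norm_nonneg w)]
      have hd : Metric.infDist (x + ((i : ℝ) * h) • w) C ≤ i * h * ‖w‖ := by
        rw [← hlen _ hs, ← dist_eq_norm]
        exact Metric.infDist_le_dist_of_mem hx
      have hstep := infDist_add_smul_sq_le hC hx hδ hz hh
      have heq : x + (((i + 1 : ℕ) : ℝ) * h) • w = x + ((i : ℝ) * h) • w + h • w := by
        rw [add_assoc, ← add_smul]; push_cast; ring_nf
      rw [heq]
      have h1 : 2 * h * η * Metric.infDist (x + ((i : ℝ) * h) • w) C ≤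
          2 * h * η * (i * h * ‖w‖) := by gcongr
      have h2 : 0 ≤ η * ‖w‖ * h ^ 2 := by positivity
      push_cast
      nlinarith
  have hbound : ∀ N : ℕ, Metric.infDist (x + T • w) C ^ 2 ≤
      c ^ 2 * T ^ 2 + T ^ 2 * ‖w‖ ^ 2 * (1 / ((N : ℝ) + 1)) := by
    intro N
    have h := hiter (N + 1) N.succ_pos (N + 1) le_rfl
    have hN : (((N + 1 : ℕ) : ℝ)) ≠ 0 := by positivity
    rw [mul_div_cancel₀ _ hN] at h
    refine h.trans ?_
    have e1 : η * ‖w‖ * (T / ((N + 1 : ℕ) : ℝ)) ^ 2 * ((N + 1 : ℕ) : ℝ) ^ 2 =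
        η * ‖w‖ * T ^ 2 := by field_simp
    have e2 : ((N + 1 : ℕ) : ℝ) * (T / ((N + 1 : ℕ) : ℝ)) ^ 2 * ‖w‖ ^ 2 =
        T ^ 2 * ‖w‖ ^ 2 * (1 / ((N : ℝ) + 1)) := by
      push_cast at hN ⊢
      field_simp
    rw [e1, e2]
    gcongr
  have hsq : Metric.infDist (x + T • w) C ^ 2 ≤ c ^ 2 * T ^ 2 := by
    refine ge_of_tendsto' (x := atTop)
      (f := fun N : ℕ => c ^ 2 * T ^ 2 + T ^ 2 * ‖w‖ ^ 2 * (1 / ((N : ℝ) + 1))) ?_ hbound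
    simpa using (tendsto_one_div_add_atTop_nhds_zero_nat (𝕜 := ℝ)).const_mul
      (T ^ 2 * ‖w‖ ^ 2) |>.const_add (c ^ 2 * T ^ 2)
  rw [← mul_pow] at hsq
  exact le_of_sq_le_sq hsq (by positivity)

/-- The polar of the normal cone of a closed set consists of tangents. -/
theorem mem_tangentCone_of_mem_polar [FiniteDimensional ℝ E] {C : Set E}
    (hC : IsClosed C) {x w : E} (hx : x ∈ C) (hw : ∀ v ∈ normalCone C x, inner ℝ v w ≤ 0) :
    w ∈ tangentCone C x := by
  set t : ℕ → ℝ := fun i => 1 / ((i : ℝ) + 1) with ht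
  have ht0 : ∀ i, 0 < t i := fun i => Nat.one_div_pos_of_nat
  have htlim : Tendsto t atTop (𝓝 0) := tendsto_one_div_add_atTop_nhds_zero_nat
  choose p hpC hp using fun i => hC.exists_infDist_eq_dist ⟨x, hx⟩ (x + t i • w)
  have hdir : Tendsto (fun i => (t i)⁻¹ • (p i - x)) atTop (𝓝 w) := by
    rw [tendsto_iff_norm_sub_tendsto_zero, Metric.tendsto_nhds]
    intro ε hε
    obtain ⟨δ, hδ0, hδ⟩ := exists_forall_infDist_le_of_mem_polar hC hx hw (half_pos hε)
    filter_upwards [htlim.eventually_lt_const hδ0] with i hi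
    have h1 := hδ (t i) (ht0 i) hi
    rw [hp, dist_eq_norm, norm_sub_rev] at h1
    have h2 : (t i)⁻¹ • (p i - x) - w = (t i)⁻¹ • (p i - (x + t i • w)) := by
      rw [← sub_sub, smul_sub _ (p i - x), smul_smul, inv_mul_cancel₀ (ht0 i).ne', one_smul]
    rw [dist_zero_right, norm_norm, h2, norm_smul, Real.norm_of_nonneg (inv_nonneg.2 (ht0 i).le),
      inv_mul_eq_div]
    have h3 : ‖p i - (x + t i • w)‖ / t i ≤ ε / 2 := by rwa [div_le_iff₀ (ht0 i)]
    linarith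
  refine ⟨p, t, hpC, ?_, ht0, fun i j hij => ?_, htlim, hdir⟩
  · have h := (htlim.smul hdir).const_add x
    rw [zero_smul, add_zero] at h
    refine h.congr fun i => ?_
    rw [smul_smul, mul_inv_cancel₀ (ht0 i).ne', one_smul, add_sub_cancel]
  · exact Nat.one_div_le_one_div hij

/-- At a point of Clarke regularity of a closed set, the tangent cone is the polar of the regular
normal cone. -/
theorem ClarkeRegularAt.mem_tangentCone_iff [FiniteDimensional ℝ E] {C : Set E}
    (hC : IsClosed C) {x : E} (hx : x ∈ C) (hreg : ClarkeRegularAt C x) {w : E} :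
    w ∈ tangentCone C x ↔ ∀ v ∈ regularNormalCone C x, inner ℝ v w ≤ 0 :=
  ⟨fun hw _ hv => inner_nonpos_of_mem_tangentCone hv hw, fun h =>
    mem_tangentCone_of_mem_polar hC hx fun v hv => h v (hreg ▸ hv)⟩

theorem ClarkeRegularAt.convex_tangentCone [FiniteDimensional ℝ E] {C : Set E}
    (hC : IsClosed C) {x : E} (hx : x ∈ C) (hreg : ClarkeRegularAt C x) :
    Convex ℝ (tangentCone C x) := by
  intro y hy z hz a b ha hb _
  rw [hreg.mem_tangentCone_iff hC hx] at *
  intro v hv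
  rw [inner_add_right, real_inner_smul_right, real_inner_smul_right]
  nlinarith [mul_nonneg ha (neg_nonneg.2 (hy v hv)), mul_nonneg hb (neg_nonneg.2 (hz v hv))]

theorem ClarkeRegularAt.add_mem_tangentCone [FiniteDimensional ℝ E] {C : Set E}
    (hC : IsClosed C) {x : E} (hx : x ∈ C) (hreg : ClarkeRegularAt C x) {y z : E}
    (hy : y ∈ tangentCone C x) (hz : z ∈ tangentCone C x) : y + z ∈ tangentCone C x := by
  rw [hreg.mem_tangentCone_iff hC hx] at *
  intro v hv
  rw [inner_add_right]
  linarith [hy v hv, hz v hv]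

/-- For a convex set the regular normals are the normals in the sense of convex analysis. -/
theorem inner_sub_nonpos_of_mem_regularNormalCone {C : Set E} (hC : Convex ℝ C) {x v y : E}
    (hx : x ∈ C) (hv : v ∈ regularNormalCone C x) (hy : y ∈ C) : inner ℝ v (y - x) ≤ 0 := by
  refine inner_nonpos_of_mem_tangentCone hv
    ⟨fun i => x + (1 / ((i : ℝ) + 1)) • (y - x), fun i => 1 / ((i : ℝ) + 1), fun i => ?_, ?_,
      fun i => Nat.one_div_pos_of_nat, fun i j hij => Nat.one_div_le_one_div hij,
      tendsto_one_div_add_atTop_nhds_zero_nat, ?_⟩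
  · refine hC.add_smul_sub_mem hx hy ⟨Nat.one_div_pos_of_nat.le, ?_⟩
    rw [div_le_one (by positivity)]
    linarith [(Nat.cast_nonneg i : (0 : ℝ) ≤ i)]
  · simpa using ((tendsto_one_div_add_atTop_nhds_zero_nat (𝕜 := ℝ)).smul_const
      (y - x)).const_add x
  · refine tendsto_const_nhds.congr fun i => ?_
    rw [add_sub_cancel_left, smul_smul, inv_mul_cancel₀ (Nat.one_div_pos_of_nat (α := ℝ)).ne',
      one_smul]

/-- For convex sets the regular normal inequality is global, so it survives limits of base points
and normals. -/
theorem mem_normalCone_iff_of_convex {C : Set E} (hC : Convex ℝ C) {x v : E} (hx : x ∈ C) :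
    v ∈ normalCone C x ↔ ∀ y ∈ C, inner ℝ v (y - x) ≤ 0 := by
  constructor
  · rintro ⟨xs, vs, hxs, hlim, hvs, hvlim⟩ y hy
    exact le_of_tendsto' (hvlim.inner (tendsto_const_nhds.sub hlim)) fun i =>
      inner_sub_nonpos_of_mem_regularNormalCone hC (hxs i) (hvs i) hy
  · intro h
    refine regularNormalCone_subset_normalCone hx fun ε hε => ?_
    filter_upwards [self_mem_nhdsWithin] with y hy
    exact (h y hy).trans (by positivity)

end Normals

/-! ### Convex chain rule for linear preimages. -/

section ChainRule

variable {E F : Type*} [NormedAddCommGroup E] [InnerProductSpace ℝ E]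
  [NormedAddCommGroup F] [InnerProductSpace ℝ F] [CompleteSpace F]

/-- A continuous linear functional on `F × ℝ` in coordinates. -/
theorem exists_inner_add_mul_eq (φ : StrongDual ℝ (F × ℝ)) :
    ∃ (v : F) (β : ℝ), ∀ y s, φ (y, s) = inner ℝ v y + s * β := by
  refine ⟨(InnerProductSpace.toDual ℝ F).symm (φ.comp (ContinuousLinearMap.inl ℝ F ℝ)),
    φ (0, 1), fun y s => ?_⟩
  have h : (y, s) = (y, (0 : ℝ)) + s • ((0 : F), (1 : ℝ)) := by simp
  rw [h, map_add, map_smul, smul_eq_mul, InnerProductSpace.toDual_symm_apply]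
  rfl

/-- Separation of an open convex set from the graph of an affine functional that is nonpositive
on its preimage. -/
theorem exists_separation_of_normal_preimage (f : E →ₗ[ℝ] F) {O : Set F} (hO : Convex ℝ O)
    (hOo : IsOpen O) {x w : E} (hw : ∀ y, f y ∈ O → inner ℝ w (y - x) ≤ 0) :
    ∃ (v : F) (β u : ℝ), (∀ y ∈ O, ∀ s : ℝ, 0 < s → inner ℝ v y + s * β < u) ∧
      ∀ d, u ≤ inner ℝ v (f x) + (inner ℝ v (f d) + inner ℝ w d * β) := by
  have hconv : Convex ℝ (Set.range fun d : E => (f (x + d), inner ℝ w d)) := by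
    rintro _ ⟨d, rfl⟩ _ ⟨e, rfl⟩ a b _ _ hab
    refine ⟨a • d + b • e, ?_⟩
    have hxab : x + (a • d + b • e) = a • (x + d) + b • (x + e) := by
      calc x + (a • d + b • e) = (a + b) • x + (a • d + b • e) := by rw [hab, one_smul]
        _ = _ := by rw [add_smul, smul_add, smul_add]; abel
    ext
    · simp only [hxab, map_add f (a • (x + d)), map_smul, Prod.fst_add, Prod.smul_fst]
    · simp [inner_add_right, real_inner_smul_right]
  have hdisj : Disjoint (O ×ˢ Set.Ioi (0 : ℝ))
      (Set.range fun d : E => (f (x + d), inner ℝ w d)) := by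
    rw [Set.disjoint_left]
    rintro _ ⟨h1, h2⟩ ⟨d, rfl⟩
    have h := hw (x + d) h1
    rw [add_sub_cancel_left] at h
    exact absurd h (not_le.2 h2)
  obtain ⟨φ, u, hlt, hge⟩ := geometric_hahn_banach_open
    (hO.prod (convex_Ioi 0)) (hOo.prod isOpen_Ioi) hconv hdisj
  obtain ⟨v, β, hφ⟩ := exists_inner_add_mul_eq φ
  refine ⟨v, β, u, fun y hy s hs => ?_, fun d => ?_⟩
  · rw [← hφ]; exact hlt _ ⟨hy, hs⟩
  · have h := hge _ ⟨d, rfl⟩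
    rw [hφ, map_add, inner_add_right] at h
    linarith

/-- The nontrivial half of the convex chain rule under a Slater condition. -/
theorem exists_normal_of_normal_preimage (f : E →ₗ[ℝ] F) (g : F →ₗ[ℝ] E)
    (hfg : ∀ x y, inner ℝ (g y) x = inner ℝ y (f x)) {C : Set F} (hC : Convex ℝ C) {x z w : E}
    (hz : f z ∈ interior C) (hw : ∀ y, f y ∈ C → inner ℝ w (y - x) ≤ 0) :
    ∃ v, (∀ y ∈ C, inner ℝ v (y - f x) ≤ 0) ∧ w = g v := by
  obtain ⟨v, β, u, hlt', hge'⟩ := exists_separation_of_normal_preimage f hC.interior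
    isOpen_interior fun y hy => hw y (interior_subset hy)
  -- An affine function bounded below has zero linear part: otherwise a multiple of `d` gives the
  -- value `u - 1`.
  have hzero : ∀ d, inner ℝ v (f d) + inner ℝ w d * β = 0 := by
    intro d
    set q := inner ℝ v (f d) + inner ℝ w d * β with hq
    by_contra hne
    have h := hge' (((u - inner ℝ v (f x) - 1) / q) • d)
    rw [map_smul, real_inner_smul_right, real_inner_smul_right] at h
    have e : (u - inner ℝ v (f x) - 1) / q * inner ℝ v (f d) +
        (u - inner ℝ v (f x) - 1) / q * inner ℝ w d * β = u - inner ℝ v (f x) - 1 := by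
      rw [mul_assoc, ← mul_add, ← hq, div_mul_cancel₀ _ hne]
    linarith
  have hux : u ≤ inner ℝ v (f x) := by simpa using hge' 0
  have hle : ∀ y ∈ C, inner ℝ v y ≤ u := by
    have hint : ∀ y ∈ interior C, inner ℝ v y ≤ u := by
      intro y hy
      have hcont : Tendsto (fun s : ℝ => inner ℝ v y + s * β) (𝓝[>] 0) (𝓝 (inner ℝ v y)) := by
        have : Continuous fun s : ℝ => inner ℝ v y + s * β := by fun_prop
        simpa using (this.tendsto 0).mono_left nhdsWithin_le_nhds
      refine le_of_tendsto hcont ?_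
      filter_upwards [self_mem_nhdsWithin] with s hs
      exact (hlt' y hy s hs).le
    intro y hy
    have hcl : y ∈ closure (interior C) := by
      rw [hC.closure_interior_eq_closure_of_nonempty_interior ⟨_, hz⟩]
      exact subset_closure hy
    have hclosed : IsClosed {y | inner ℝ v y ≤ u} :=
      isClosed_le (by fun_prop) continuous_const
    exact closure_minimal hint hclosed hcl
  -- Slater's condition excludes `β ≥ 0`: then `u ≤ ⟪v, f x⟫ ≤ ⟪v, f z⟫`, against strict separation
  -- at `(f z, 1)`.
  have hβneg : β < 0 := by
    have h0 := hzero (z - x)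
    rw [map_sub, inner_sub_right] at h0
    by_contra! hβ0
    have hwz := hw z (interior_subset hz)
    have h1 := hlt' (f z) hz 1 one_pos
    nlinarith [mul_nonneg hβ0 (neg_nonneg.2 hwz)]
  refine ⟨(-β)⁻¹ • v, fun y hy => ?_, ?_⟩
  · rw [real_inner_smul_left, inner_sub_right]
    exact mul_nonpos_of_nonneg_of_nonpos (inv_nonneg.2 (by linarith))
      (by linarith [hle y hy])
  · refine ext_inner_right ℝ fun d => ?_
    rw [map_smul, real_inner_smul_left, hfg, inv_mul_eq_div, eq_div_iff (by linarith)]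
    linarith [hzero d]

/-- The convex chain rule for normal cones of preimages under a Slater condition. -/
theorem normalCone_preimage_of_convex (f : E →ₗ[ℝ] F) (g : F →ₗ[ℝ] E)
    (hfg : ∀ x y, inner ℝ (g y) x = inner ℝ y (f x)) {C : Set F} (hC : Convex ℝ C) {x z : E}
    (hx : f x ∈ C) (hz : f z ∈ interior C) :
    normalCone (f ⁻¹' C) x = {w | ∃ v ∈ normalCone C (f x), w = g v} := by
  ext w
  rw [mem_normalCone_iff_of_convex (hC.linear_preimage f) hx]
  simp only [Set.mem_ofPred_eq, mem_normalCone_iff_of_convex hC hx]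
  refine ⟨fun hw => exists_normal_of_normal_preimage f g hfg hC hz hw, ?_⟩
  rintro ⟨v, hv, rfl⟩ y hy
  rw [hfg, map_sub]
  exact hv _ hy

end ChainRule

end RobustTangent

/-! ### Normals to the tangential feasible set. -/

theorem proposition6p3 (n k : ℕ)
    (A : Matrix (Fin k) (Fin n) ℝ) (b : EuclideanSpace ℝ (Fin k))
    (Q : Set (EuclideanSpace ℝ (Fin k))) (hQ : IsClosed Q)
    (U : Set (Matrix (Fin k) (Fin n) ℝ × EuclideanSpace ℝ (Fin k)))
    (xbar : EuclideanSpace ℝ (Fin n))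
    (hx : A.toEuclideanLin xbar - b ∈ Q)
    (hreg : RobustTangent.ClarkeRegularAt Q (A.toEuclideanLin xbar - b))
    (hCQ : ∃ γ' : EuclideanSpace ℝ (Fin n), A.toEuclideanLin γ' ∈
      interior (RobustTangent.tangentCone Q (A.toEuclideanLin xbar - b)))
    (γ : EuclideanSpace ℝ (Fin n)) (hγ : γ ∈ RobustTangent.Gam A b Q U xbar) :
    RobustTangent.normalCone (RobustTangent.Gam A b Q U xbar) γ =
      {w | ∃ v ∈ RobustTangent.normalCone (RobustTangent.Psi A b Q U xbar)
        (A.toEuclideanLin γ), w = A.transpose.toEuclideanLin v} := by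
  have hconv := hreg.convex_tangentCone hQ hx
  obtain ⟨γ', hγ'⟩ := hCQ
  have hPsi : Convex ℝ (RobustTangent.Psi A b Q U xbar) := by
    intro y hy z hz a c ha hc hac u hu
    have h := hconv (hy u hu) (hz u hu) ha hc hac
    have e : a • (y + u) + c • (z + u) = a • y + c • z + u := by
      calc a • (y + u) + c • (z + u) = a • y + c • z + (a + c) • u := by
            rw [smul_add, smul_add, add_smul]; abel
        _ = _ := by rw [hac, one_smul]
    rwa [e] at h
  have hint : A.toEuclideanLin (γ + γ') ∈ interior (RobustTangent.Psi A b Q U xbar) := by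
    -- With `y - A γ` and `A γ + u` tangent, their sum `y + u` is tangent.
    have hsub : (fun y => -A.toEuclideanLin γ + y) ⁻¹'
        interior (RobustTangent.tangentCone Q (A.toEuclideanLin xbar - b)) ⊆
        RobustTangent.Psi A b Q U xbar := by
      intro y hy u hu
      have h := hreg.add_mem_tangentCone hQ hx (interior_subset hy) (hγ u hu)
      have e : -A.toEuclideanLin γ + y + (A.toEuclideanLin γ + u) = y + u := by abel
      rwa [e] at h
    refine interior_maximal hsub (isOpen_interior.preimage (by fun_prop)) ?_
    simpa [map_add] using hγ'
  refine RobustTangent.normalCone_preimage_of_convex A.toEuclideanLin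
    A.transpose.toEuclideanLin (fun x y => ?_) hPsi hγ hint
  rw [← Matrix.conjTranspose_eq_transpose_of_trivial,
    Matrix.toEuclideanLin_conjTranspose_eq_adjoint, LinearMap.adjoint_inner_left]
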